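/- Let $\mathbf{k}$ be a field of characteristic zero. A Lie algebra $\mathfrak{L}$ over $\mathbf{k}$ (of arbitrary dimension) is called self-centralizing if for every nonzero $l\in\mathfrak{L}$, every $x\in\mathfrak{L}$ with $[l,x]=0$ is a scalar multiple of $l$. It is called semisimple if it has no nonzero solvable ideals, and indecomposable if it is not the direct sum of two nonzero Lie algebras. Proposition. Let $\mathfrak{L}$ be a self-centralizing Lie algebra over $\mathbf{k}$. Then: (a) Every Lie subalgebra of $\mathfrak{L}$ is self-centralizing. (b) If $\mathfrak{L}$ has an ideal of finite dimension $n>1$, then $\dim\mathfrak{L}\le n^2$. If $\mathfrak{L}$ has an ideal of dimension $1$, then $\dim\mathfrak{L}\le 2$. (c) If $\mathfrak{L}$ is infinite dimensional, then it has no nonzero finite-dimensional ideals. (d) If $\alpha,\beta\in\mathfrak{L}$ are linearly independent and $x$ is a common eigenvector of $\operatorname{ad}(\alpha)$ and $\operatorname{ad}(\beta)$, then $x$ is a scalar multiple of $[\alpha,\beta]$. (e) If $\alpha,\beta\in\mathfrak{L}$ are linearly independent, then there is no basis of $\mathfrak{L}$ in which both $\operatorname{ad}(\alpha)$ and $\operatorname{ad}(\beta)$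 are diagonal. (f) $\mathfrak{L}$ is indecomposable. (g) If $\dim\mathfrak{L}>2$, then $\mathfrak{L}$ is semisimple. (h) If $\mathfrak{L}$ is finite dimensional and $\mathbf{k}$ is algebraically closed, then $\mathfrak{L}$ is isomorphic to the nonabelian Lie algebra of dimension two, or is isomorphic to $\mathfrak{sl}_2(\mathbf{k})$, or has dimension at most one. Moreover, let $\mathbf{R}=\mathbf{k}((x))$ be the field of fractions of $\mathbf{k}[[x]]$, let $\partial$ be formal differentiation on $\mathbf{R}$, let $A\subseteq\mathbf{R}$ be a $\mathbf{k}$-subalgebra with $\partial(A)\subseteq A$, and let $\operatorname{Witt}(A)=\{f\partial : f\in A\}\subseteq\operatorname{End}_{\mathbf{k}}(\mathbf{R})$ with the commutator bracket. If $\operatorname{Witt}(A)$ is infinite dimensional, then it is semisimple and indecomposable. -/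

import Mathlib

universe u v w

attribute [local instance 100] LieRing.ofAssociativeRing

-- the coefficientwise `k`-algebra structure on Laurent series
attribute [local instance 2000] HahnSeries.instAlgebra

open scoped LaurentSeries

noncomputable section

namespace SelfCent

section LieAlgebras

variable (k : Type u) [Field k] (L : Type v) [LieRing L] [LieAlgebra k L]

/-- A Lie algebra is self-centralizing if the centralizer of every nonzero element `l`
consists of the scalar multiples of `l`. -/
def IsSelfCentralizing : Prop :=
  ∀ l : L, l ≠ 0 → ∀ x : L, ⁅l, x⁆ = 0 → ∃ β : k, x = β • l

/-- A Lie algebra is semisimple if it has no nonzero solvable ideals. -/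
def IsSemisimple : Prop :=
  ∀ I : LieIdeal k L, LieAlgebra.IsSolvable I → I = ⊥

/-- A Lie algebra is indecomposable if it is not the direct sum of two nonzero ideals
(the external formulation is `isIndecomposable_iff` below). -/
def IsIndecomposable : Prop :=
  ∀ I J : LieIdeal k L, IsCompl I J → I = ⊥ ∨ J = ⊥

variable {k L} in
/-- A basis in which `ad α` is diagonal. -/
def IsAdDiagonal {ι : Type w} (b : Module.Basis ι k L) (α : L) : Prop :=
  ∀ i, ∃ a : k, ⁅α, b i⁆ = a • b i

/-- The nonabelian Lie algebra of dimension two, realized as the `2 × 2` matrices with zero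
second row: the matrix units `x = E₀₀`, `y = E₀₁` form a basis and `⁅x, y⁆ = y`. -/
def nonabelianTwoDim : LieSubalgebra k (Matrix (Fin 2) (Fin 2) k) where
  carrier := {M | M 1 0 = 0 ∧ M 1 1 = 0}
  add_mem' := by
    rintro M N ⟨h1, h2⟩ ⟨h3, h4⟩
    simp [h1, h2, h3, h4]
  zero_mem' := by simp
  smul_mem' := by
    rintro c M ⟨h1, h2⟩
    simp [h1, h2]
  lie_mem' := by
    rintro M N ⟨h1, h2⟩ ⟨h3, h4⟩
    simp only [LieRing.of_associative_ring_bracket, Set.mem_ofPred_eq, Matrix.sub_apply,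
      Matrix.mul_apply, Fin.sum_univ_two] at *
    simp [h1, h2, h3, h4]

end LieAlgebras

/-- Indecomposability says that `L` is not isomorphic to a direct sum of two nonzero
Lie algebras. -/
theorem isIndecomposable_iff (k : Type u) [Field k] (L : Type v) [LieRing L] [LieAlgebra k L] :
    IsIndecomposable k L ↔
      ∀ (L₁ L₂ : Type v) [LieRing L₁] [LieRing L₂] [LieAlgebra k L₁] [LieAlgebra k L₂],
        Nonempty (L ≃ₗ⁅k⁆ L₁ × L₂) → Subsingleton L₁ ∨ Subsingleton L₂ := by
  constructor
  · rintro h L₁ L₂ _ _ _ _ ⟨e⟩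
    let f : L →ₗ⁅k⁆ L₁ := (LieHom.fst k L₁ L₂).comp e.toLieHom
    let g : L →ₗ⁅k⁆ L₂ := (LieHom.snd k L₁ L₂).comp e.toLieHom
    have hf : ∀ x, f x = (e x).1 := fun _ => rfl
    have hg : ∀ x, g x = (e x).2 := fun _ => rfl
    have hc : IsCompl f.ker g.ker := by
      constructor
      · rw [disjoint_iff, LieSubmodule.eq_bot_iff]
        intro x hx
        rw [LieSubmodule.mem_inf, LieHom.mem_ker, LieHom.mem_ker, hf, hg] at hx
        apply e.injective
        rw [map_zero]
        exact Prod.ext hx.1 hx.2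
      · rw [codisjoint_iff, eq_top_iff]
        intro x _
        rw [LieSubmodule.mem_sup]
        refine ⟨e.symm (0, (e x).2), ?_, e.symm ((e x).1, 0), ?_, ?_⟩
        · rw [LieHom.mem_ker, hf]; simp
        · rw [LieHom.mem_ker, hg]; simp
        · rw [← map_add]; simp
    rcases h _ _ hc with h0 | h0
    · right
      refine subsingleton_of_forall_eq 0 fun y => ?_
      have : e.symm (0, y) ∈ f.ker := by rw [LieHom.mem_ker, hf]; simp
      rw [h0, LieSubmodule.mem_bot] at this
      have h2 := congrArg e this
      simpa using h2
    · left
      refine subsingleton_of_forall_eq 0 fun y => ?_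
      have : e.symm (y, 0) ∈ g.ker := by rw [LieHom.mem_ker, hg]; simp
      rw [h0, LieSubmodule.mem_bot] at this
      have h2 := congrArg e this
      simpa using h2
  · intro h I J hc
    have hdis : ∀ x : L, x ∈ I → x ∈ J → x = 0 := by
      intro x h1 h2
      have h3 : x ∈ I ⊓ J := (LieSubmodule.mem_inf I J x).2 ⟨h1, h2⟩
      rw [hc.inf_eq_bot] at h3
      simpa using h3
    let φ : I × J →ₗ⁅k⁆ L :=
      { toFun := fun p => (p.1 : L) + p.2
        map_add' := by intro p q; simp; abel
        map_smul' := by intro c p; simp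
        map_lie' := by
          rintro ⟨x, y⟩ ⟨x', y'⟩
          have h1 : ⁅(x : L), (y' : L)⁆ = 0 :=
            hdis _ (lie_mem_left k L I _ _ x.2) (lie_mem_right k L J _ _ y'.2)
          have h2 : ⁅(y : L), (x' : L)⁆ = 0 :=
            hdis _ (lie_mem_right k L I _ _ x'.2) (lie_mem_left k L J _ _ y.2)
          simp [h1, h2] }
    have hφ : ∀ p, φ p = (p.1 : L) + p.2 := fun _ => rfl
    have hbij : Function.Bijective φ := by
      constructor
      · rw [injective_iff_map_eq_zero]
        rintro ⟨x, y⟩ hxy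
        rw [hφ] at hxy
        have hx : (x : L) = -(y : L) := eq_neg_of_add_eq_zero_left hxy
        have hx0 : (x : L) = 0 := hdis _ x.2 (by rw [hx]; exact neg_mem y.2)
        have hy0 : (y : L) = 0 := by simpa [hx0] using hxy
        exact Prod.ext (Subtype.ext hx0) (Subtype.ext hy0)
      · intro x
        have : x ∈ I ⊔ J := by rw [hc.sup_eq_top]; trivial
        rw [LieSubmodule.mem_sup] at this
        obtain ⟨y, hy, z, hz, rfl⟩ := this
        exact ⟨(⟨y, hy⟩, ⟨z, hz⟩), rfl⟩
    rcases h I J ⟨(LieEquiv.ofBijective φ hbij).symm⟩ with h0 | h0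
    · left
      by_contra hne
      exact not_subsingleton_iff_nontrivial.2 (LieSubmodule.nontrivial_iff_ne_bot k L L |>.2 hne) h0
    · right
      by_contra hne
      exact not_subsingleton_iff_nontrivial.2 (LieSubmodule.nontrivial_iff_ne_bot k L L |>.2 hne) h0

section Witt

variable (k : Type u) [Field k]

theorem coeff_euler (f : k⸨X⸩) (n : ℤ) :
    (HahnSeries.single (1 : ℤ) (1 : k) * LaurentSeries.derivative k f).coeff n
      = (n : k) * f.coeff n := by
  have h := HahnSeries.coeff_single_mul_add (r := (1 : k)) (x := LaurentSeries.derivative k f)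
    (a := n - 1) (b := (1 : ℤ))
  rw [sub_add_cancel] at h
  rw [h, LaurentSeries.derivative_apply, LaurentSeries.hasseDeriv_coeff]
  simp

/-- The Leibniz rule for formal differentiation of Laurent series. -/
theorem derivative_mul (f g : k⸨X⸩) :
    LaurentSeries.derivative k (f * g)
      = f * LaurentSeries.derivative k g + LaurentSeries.derivative k f * g := by
  have hs : (HahnSeries.single (1 : ℤ) (1 : k) : k⸨X⸩) ≠ 0 := by simp
  apply mul_left_cancel₀ hs
  have e : HahnSeries.single (1 : ℤ) (1 : k) *
      (f * LaurentSeries.derivative k g + LaurentSeries.derivative k f * g)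
      = f * (HahnSeries.single (1 : ℤ) (1 : k) * LaurentSeries.derivative k g)
        + (HahnSeries.single (1 : ℤ) (1 : k) * LaurentSeries.derivative k f) * g := by ring
  rw [e]
  ext n
  have hsup : ∀ h : k⸨X⸩,
      (HahnSeries.single (1 : ℤ) (1 : k) * LaurentSeries.derivative k h).support
        ⊆ h.support := by
    intro h i hi hi0
    apply hi
    change (HahnSeries.single (1 : ℤ) (1 : k) * LaurentSeries.derivative k h).coeff i = 0
    rw [coeff_euler, hi0, mul_zero]
  rw [coeff_euler, HahnSeries.coeff_add, HahnSeries.coeff_mul,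
    HahnSeries.coeff_mul_right' g.isPWO_support (hsup g),
    HahnSeries.coeff_mul_left' f.isPWO_support (hsup f), Finset.mul_sum,
    ← Finset.sum_add_distrib]
  refine Finset.sum_congr rfl fun ij hij => ?_
  rw [Finset.mem_antidiagonal] at hij
  rw [coeff_euler, coeff_euler, ← hij.2.2]
  push_cast
  ring

variable {k} in
/-- A stable algebra: a subalgebra of the field `k⸨X⸩` of fractions of `k⟦X⟧` closed under
formal differentiation. -/
def IsStable (A : Subalgebra k k⸨X⸩) : Prop :=
  ∀ f ∈ A, LaurentSeries.derivative k f ∈ A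

variable {k} in
/-- The operator `f∂` on `k⸨X⸩`: differentiate, then multiply by `f`. -/
def mulDeriv (f : k⸨X⸩) : Module.End k k⸨X⸩ :=
  LinearMap.mulLeft k f * LaurentSeries.derivative k

variable {k} in
/-- The generalized Witt algebra of a stable algebra `A`: the operators `f∂` with `f ∈ A`,
with the commutator bracket of `End_k(k⸨X⸩)`. -/
def Witt (A : Subalgebra k k⸨X⸩) (hA : IsStable A) : LieSubalgebra k (Module.End k k⸨X⸩) where
  carrier := {T | ∃ f ∈ A, T = mulDeriv f}
  add_mem' := by
    rintro _ _ ⟨f, hf, rfl⟩ ⟨g, hg, rfl⟩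
    refine ⟨f + g, add_mem hf hg, ?_⟩
    ext1 h
    simp [mulDeriv, add_mul]
  zero_mem' := ⟨0, zero_mem A, by ext1 h; simp [mulDeriv]⟩
  smul_mem' := by
    rintro c _ ⟨f, hf, rfl⟩
    refine ⟨c • f, A.smul_mem hf c, ?_⟩
    ext1 h
    simp [mulDeriv]
  lie_mem' := by
    rintro _ _ ⟨f, hf, rfl⟩ ⟨g, hg, rfl⟩
    refine ⟨f * LaurentSeries.derivative k g - g * LaurentSeries.derivative k f,
      sub_mem (mul_mem hf (hA g hg)) (mul_mem hg (hA f hf)), ?_⟩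
    refine LinearMap.ext fun h => ?_
    simp only [LieRing.of_associative_ring_bracket, mulDeriv, LinearMap.sub_apply,
      Module.End.mul_apply, LinearMap.mulLeft_apply, derivative_mul]
    ring

end Witt

end SelfCent

end

namespace SelfCent

/-! ### Ideals, common eigenvectors and decompositions -/

section Structure

variable {k : Type u} [Field k] {L : Type v} [LieRing L] [LieAlgebra k L]

/-! An element commuting with two independent vectors is zero. So an ideal of dimension above one is
acted on faithfully, which bounds the dimension of the algebra; commuting ideals cannot be
independent, and abelian ideals have dimension at most one. For the classification, Engel's theorem
yields `⁅h, x⁆ = x` with `x ≠ 0` (otherwise the centre is nonzero). Raising by `ad x` can stop only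
on multiples of `x`, which forces the eigenvalues of `ad h` into `{1, 0, -1}` and leaves dimension
two or three. In a Witt algebra, `⁅f∂, g∂⁆ = f² (g/f)' ∂` for `f ≠ 0`, so it is self-centralizing in
characteristic zero and the general results apply. -/

theorem IsSelfCentralizing.subalgebra (h : IsSelfCentralizing k L) (K : LieSubalgebra k L) :
    IsSelfCentralizing k K := by
  intro l hl x hx
  obtain ⟨c, hc⟩ := h l (by simpa using hl) x (by simpa using congrArg Subtype.val hx)
  exact ⟨c, Subtype.ext hc⟩

/-- An ideal of dimension at least two of a self-centralizing Lie algebra has trivial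
centralizer. -/
theorem IsSelfCentralizing.toEnd_injective (h : IsSelfCentralizing k L) (I : LieIdeal k L)
    (hI : 1 < Module.rank k I) : Function.Injective (LieModule.toEnd k L I) := by
  rw [injective_iff_map_eq_zero]
  intro x hx
  by_contra hx0
  refine hI.not_ge (rank_submodule_le_one_iff' I.toSubmodule |>.2 ⟨x, fun y hy => ?_⟩)
  have h1 : ⁅x, y⁆ = 0 := by
    simpa using congrArg Subtype.val (LinearMap.congr_fun hx ⟨y, hy⟩)
  obtain ⟨c, rfl⟩ := h x hx0 y h1
  exact Submodule.smul_mem _ _ (Submodule.mem_span_singleton_self x)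

theorem rank_end (I : LieIdeal k L) [FiniteDimensional k I] :
    Module.rank k (Module.End k I) = ((Module.finrank k I ^ 2 : ℕ) : Cardinal.{v}) := by
  rw [← Module.finrank_eq_rank, Module.finrank_linearMap, sq]

theorem IsSelfCentralizing.rank_le_sq (h : IsSelfCentralizing k L) (I : LieIdeal k L) (n : ℕ)
    (hn : 1 < n) (hI : Module.rank k I = n) :
    Module.rank k L ≤ ((n ^ 2 : ℕ) : Cardinal.{v}) := by
  have : FiniteDimensional k I :=
    Module.rank_lt_aleph0_iff.1 (hI ▸ Cardinal.natCast_lt_aleph0)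
  have hfr : Module.finrank k I = n := Module.finrank_eq_of_rank_eq hI
  have hinj := h.toEnd_injective I (by rw [hI]; exact_mod_cast hn)
  rw [← hfr, ← rank_end]
  exact LinearMap.rank_le_of_injective (LieModule.toEnd k L I : L →ₗ[k] Module.End k I) hinj

theorem IsSelfCentralizing.rank_le_two (h : IsSelfCentralizing k L) (I : LieIdeal k L)
    (hI : Module.rank k I = 1) : Module.rank k L ≤ 2 := by
  have : FiniteDimensional k I := Module.rank_lt_aleph0_iff.1 (hI ▸ Cardinal.one_lt_aleph0)
  have hfr : Module.finrank k I = 1 := Module.finrank_eq_of_rank_eq (by simpa using hI)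
  obtain ⟨v, hv, -⟩ := finrank_eq_one_iff'.1 hfr
  let f : L →ₗ[k] Module.End k I := LieModule.toEnd k L I
  -- The range lies in the one-dimensional `End I`; the kernel centralizes `v`, hence lies in its
  -- span.
  rw [← LinearMap.rank_range_add_rank_ker f, ← one_add_one_eq_two]
  refine add_le_add ?_ ?_
  · refine (Submodule.rank_le _).trans ?_
    rw [rank_end, hfr]
    simp
  · refine (rank_submodule_le_one_iff' _).2 ⟨v, fun x hx => ?_⟩
    have h1 : ⁅x, (v : L)⁆ = 0 :=
      congrArg Subtype.val (LinearMap.congr_fun (LinearMap.mem_ker.1 hx) v)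
    obtain ⟨c, rfl⟩ := h v (by simpa using hv) x (by rw [← lie_skew, h1, neg_zero])
    exact Submodule.smul_mem _ _ (Submodule.mem_span_singleton_self _)

theorem IsSelfCentralizing.ideal_eq_bot (h : IsSelfCentralizing k L)
    (hL : ¬ FiniteDimensional k L) (I : LieIdeal k L) (hI : FiniteDimensional k I) : I = ⊥ := by
  by_contra hne
  have hlt : ∀ n : ℕ, ¬ Module.rank k L ≤ n := fun n hn =>
    hL (Module.rank_lt_aleph0_iff.1 (hn.trans_lt Cardinal.natCast_lt_aleph0))
  have : Nontrivial I := (LieSubmodule.nontrivial_iff_ne_bot k L L).2 hne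
  have hpos : 0 < Module.finrank k I := Module.finrank_pos
  rcases Nat.lt_or_ge 1 (Module.finrank k I) with h1 | h1
  · exact hlt _ (h.rank_le_sq I _ h1 (Module.finrank_eq_rank k I).symm)
  · refine hlt 2 (h.rank_le_two I ?_)
    rw [← Module.finrank_eq_rank, show Module.finrank k I = 1 by omega, Nat.cast_one]

/-- The combination `b • α - a • β` commutes with `x`, so it equals `c • x`; bracketing this with
`α` or `β` compares `x` with `⁅α, β⁆`. -/
theorem IsSelfCentralizing.eq_smul_lie (h : IsSelfCentralizing k L) {α β x : L}
    (hli : LinearIndependent k ![α, β]) {a b : k} (hx : x ≠ 0) (ha : ⁅α, x⁆ = a • x)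
    (hb : ⁅β, x⁆ = b • x) : ∃ c : k, x = c • ⁅α, β⁆ := by
  rw [LinearIndependent.pair_iff] at hli
  obtain ⟨c, hc⟩ := h x hx (b • α - a • β) (by
    rw [lie_sub, lie_smul, lie_smul, ← lie_skew, ← lie_skew x β, ha, hb]
    module)
  by_cases hc0 : c = 0
  -- Independence gives `a = b = 0`, so `α` and `β` are both multiples of `x`, a contradiction.
  · obtain ⟨hb0, ha0⟩ := hli b (-a) (by rw [neg_smul, ← sub_eq_add_neg, hc, hc0, zero_smul])
    obtain rfl : a = 0 := by simpa using ha0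
    obtain rfl := hb0
    rw [zero_smul] at ha hb
    obtain ⟨s, rfl⟩ := h x hx α (by rw [← lie_skew, ha, neg_zero])
    obtain ⟨t, rfl⟩ := h x hx β (by rw [← lie_skew, hb, neg_zero])
    obtain ⟨rfl, hs⟩ := hli t (-s) (by module)
    obtain rfl : s = 0 := by simpa using hs
    simpa using hli 1 1 (by simp)
  · have e1 : (a * c) • x = (-a) • ⁅α, β⁆ := by
      rw [mul_comm, mul_smul, ← ha, ← lie_smul, ← hc]
      simp
    have e2 : (b * c) • x = (-b) • ⁅α, β⁆ := by
      rw [mul_comm, mul_smul, ← hb, ← lie_smul, ← hc, ← lie_skew α β]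
      simp only [lie_sub, lie_smul, lie_self]
      module
    by_cases ha0 : a = 0
    · have hb0 : b ≠ 0 := by
        rintro rfl
        rw [ha0] at hc
        have : c • x = 0 := by rw [← hc]; simp
        exact (smul_ne_zero hc0 hx) this
      refine ⟨(b * c)⁻¹ * (-b), ?_⟩
      rw [mul_smul, ← e2, inv_smul_smul₀ (mul_ne_zero hb0 hc0)]
    · refine ⟨(a * c)⁻¹ * (-a), ?_⟩
      rw [mul_smul, ← e1, inv_smul_smul₀ (mul_ne_zero ha0 hc0)]

/-- Every basis vector is a common eigenvector, hence a multiple of `⁅α, β⁆`; then `L` is at most a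
line and cannot contain an independent pair. -/
theorem IsSelfCentralizing.not_isAdDiagonal (h : IsSelfCentralizing k L) {α β : L}
    (hli : LinearIndependent k ![α, β]) {ι : Type w} (b : Module.Basis ι k L)
    (hα : IsAdDiagonal b α) (hβ : IsAdDiagonal b β) : False := by
  have hspan : (⊤ : Submodule k L) ≤ Submodule.span k {⁅α, β⁆} := by
    rw [← b.span_eq, Submodule.span_le]
    rintro _ ⟨i, rfl⟩
    obtain ⟨s, hs⟩ := hα i
    obtain ⟨t, ht⟩ := hβ i
    obtain ⟨c, hc⟩ := h.eq_smul_lie hli (b.ne_zero i) hs ht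
    rw [hc]
    exact Submodule.smul_mem _ _ (Submodule.mem_span_singleton_self _)
  obtain ⟨s, hs⟩ := Submodule.mem_span_singleton.1 (hspan (x := α) trivial)
  obtain ⟨t, ht⟩ := Submodule.mem_span_singleton.1 (hspan (x := β) trivial)
  rw [LinearIndependent.pair_iff] at hli
  have hst : t • α + -s • β = 0 := by
    rw [neg_smul, ← sub_eq_add_neg, sub_eq_zero]
    conv_lhs => rw [← hs, smul_comm, ht]
  obtain ⟨-, hs0⟩ := hli t (-s) hst
  rw [neg_eq_zero.1 hs0, zero_smul] at hs
  simpa using hli 1 0 (by simp [← hs])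

theorem exists_mem_ne_zero {I : LieIdeal k L} (hI : I ≠ ⊥) : ∃ x ∈ I, x ≠ 0 := by
  by_contra! h
  exact hI ((LieSubmodule.eq_bot_iff I).2 h)

theorem IsSelfCentralizing.isIndecomposable (h : IsSelfCentralizing k L) :
    IsIndecomposable k L := by
  intro I J hc
  by_contra! hne
  have hdis : ∀ x : L, x ∈ I → x ∈ J → x = 0 := by
    intro x h1 h2
    have h3 : x ∈ I ⊓ J := (LieSubmodule.mem_inf I J x).2 ⟨h1, h2⟩
    rw [hc.inf_eq_bot] at h3
    simpa using h3
  obtain ⟨x, hx, hx0⟩ := exists_mem_ne_zero hne.1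
  obtain ⟨y, hy, hy0⟩ := exists_mem_ne_zero hne.2
  -- Complementary ideals commute, so `y` is a multiple of `x` and lies in both.
  obtain ⟨c, rfl⟩ := h x hx0 y (hdis _ (lie_mem_left k L I _ _ hx) (lie_mem_right k L J _ _ hy))
  exact hy0 (hdis _ (I.smul_mem c hx) hy)

/-- A nonzero solvable ideal would produce a nonzero abelian ideal, necessarily a line, and an ideal
of dimension one bounds the dimension of `L` by two. -/
theorem IsSelfCentralizing.isSemisimple (h : IsSelfCentralizing k L)
    (hL : 2 < Module.rank k L) : IsSemisimple k L := by
  intro I hI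
  by_contra hne
  rw [← LieAlgebra.abelian_of_solvable_ideal_eq_bot_iff (R := k)] at hne
  have hab := LieAlgebra.abelian_derivedAbelianOfIdeal (R := k) I
  set J := LieAlgebra.derivedAbelianOfIdeal I
  refine hL.not_ge (h.rank_le_two J ?_)
  obtain ⟨x, hx, hx0⟩ := exists_mem_ne_zero hne
  refine rank_eq_one_iff.2 ⟨⟨x, hx⟩, by simpa using hx0, fun y => ?_⟩
  have h1 : ⁅(⟨x, hx⟩ : J), y⁆ = 0 := trivial_lie_zero _ _ _ _
  obtain ⟨c, hc⟩ := h x hx0 y (by simpa using congrArg Subtype.val h1)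
  exact ⟨c, Subtype.ext hc.symm⟩

end Structure

/-! ### Generalized Witt algebras -/

section Witt

variable {k : Type u} [Field k]

theorem lie_mulDeriv (f g : k⸨X⸩) :
    ⁅mulDeriv f, mulDeriv g⁆
      = mulDeriv (f * LaurentSeries.derivative k g - g * LaurentSeries.derivative k f) := by
  refine LinearMap.ext fun h => ?_
  simp only [LieRing.of_associative_ring_bracket, mulDeriv, LinearMap.sub_apply,
    Module.End.mul_apply, LinearMap.mulLeft_apply, derivative_mul]
  ring

theorem mulDeriv_injective : Function.Injective (mulDeriv : k⸨X⸩ → Module.End k k⸨X⸩) := by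
  intro f g hfg
  have hX : LaurentSeries.derivative k (HahnSeries.single (1 : ℤ) (1 : k)) = 1 := by
    have hs : (HahnSeries.single (1 : ℤ) (1 : k) : k⸨X⸩) ≠ 0 := by simp
    apply mul_left_cancel₀ hs
    ext n
    rw [coeff_euler, mul_one, HahnSeries.coeff_single]
    split_ifs with h <;> simp [h]
  -- Evaluating `f∂` at `X` recovers `f`.
  have h1 := LinearMap.congr_fun hfg (HahnSeries.single (1 : ℤ) (1 : k))
  simpa [mulDeriv, hX] using h1

theorem mulDeriv_smul (c : k) (f : k⸨X⸩) : mulDeriv (c • f) = c • mulDeriv f := by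
  ext1 h
  simp [mulDeriv]

/-- The Euler operator `X∂` multiplies the `n`-th coefficient by `n`, which is invertible in `k` for
`n ≠ 0`. -/
theorem eq_single_of_derivative_eq_zero [CharZero k] {q : k⸨X⸩}
    (hq : LaurentSeries.derivative k q = 0) : q = HahnSeries.single 0 (q.coeff 0) := by
  ext n
  have h1 := coeff_euler k q n
  rw [hq, mul_zero, HahnSeries.coeff_zero, eq_comm, mul_eq_zero] at h1
  rw [HahnSeries.coeff_single]
  split_ifs with h
  · rw [h]
  · exact h1.resolve_left (by exact_mod_cast h)

theorem isSelfCentralizing_witt [CharZero k] (A : Subalgebra k k⸨X⸩) (hA : IsStable A) :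
    IsSelfCentralizing k (Witt A hA) := by
  rintro ⟨_, f, hf, rfl⟩ hl ⟨_, g, hg, rfl⟩ hx
  have hf0 : f ≠ 0 := by
    rintro rfl
    apply hl
    ext1
    ext1 h
    simp [mulDeriv]
  have h1 : ⁅mulDeriv f, mulDeriv g⁆ = mulDeriv 0 := by
    have h2 := congrArg Subtype.val hx
    rw [LieSubalgebra.coe_bracket] at h2
    rw [h2]
    ext1 h
    simp [mulDeriv]
  rw [lie_mulDeriv] at h1
  have h2 := mulDeriv_injective h1
  -- With `g = f q`, the coefficient `f g' - g f'` becomes `f² q'`, so `q` is constant. The quotient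
  -- is taken in the field of Laurent series and need not lie in `A` a priori.
  have hg' : g = f * (g / f) := by field_simp
  set q := g / f
  have h3 : LaurentSeries.derivative k q = 0 := by
    rw [hg', derivative_mul] at h2
    have h4 : f * f * LaurentSeries.derivative k q = 0 := by linear_combination h2
    simpa [hf0] using h4
  refine ⟨q.coeff 0, Subtype.ext ?_⟩
  change mulDeriv g = q.coeff 0 • mulDeriv f
  rw [← mulDeriv_smul, hg', eq_single_of_derivative_eq_zero h3]
  congr 1
  rw [mul_comm, ← HahnSeries.C_apply, ← HahnSeries.C_mul_eq_smul]
  simp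

theorem two_lt_rank {V : Type v} [AddCommGroup V] [Module k V] (hV : ¬ FiniteDimensional k V) :
    2 < Module.rank k V := by
  by_contra h
  exact hV (Module.rank_lt_aleph0_iff.1 ((not_lt.1 h).trans_lt (Cardinal.natCast_lt_aleph0 (n := 2))))

end Witt

end SelfCent

namespace SelfCent

/-! ### Classification over an algebraically closed field -/

section AlgClosed

variable {k : Type u} [Field k] {L : Type v} [LieRing L] [LieAlgebra k L]

open Module.End

/-- If `ad h` has an eigenvector `x` with nonzero eigenvalue `a`, then every eigenvalue of `ad h`
lies in `a - ℕ a`. -/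
theorem IsSelfCentralizing.exists_add_smul_eq [CharZero k] [FiniteDimensional k L]
    (hL : IsSelfCentralizing k L) {h x y : L} {a μ : k} (ha : a ≠ 0) (hx0 : x ≠ 0)
    (hx : ⁅h, x⁆ = a • x) (hy0 : y ≠ 0) (hy : ⁅h, y⁆ = μ • y) : ∃ j : ℕ, μ + j * a = a := by
  by_contra! hne
  -- Applying `ad x` repeatedly to `y` can only reach zero after a multiple of `x`, whose eigenvalue
  -- is `a`. If `a` is never hit, `ad h` has infinitely many eigenvalues.
  have key : ∀ j : ℕ, ∃ z : L, z ≠ 0 ∧ ⁅h, z⁆ = (μ + j * a) • z := by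
    intro j
    induction j with
    | zero => exact ⟨y, hy0, by simpa using hy⟩
    | succ j ih =>
      obtain ⟨z, hz0, hz⟩ := ih
      refine ⟨⁅x, z⁆, fun h0 => ?_, ?_⟩
      · obtain ⟨c, rfl⟩ := hL x hx0 z h0
        rw [lie_smul, hx, smul_comm c a x] at hz
        exact hne j (smul_left_injective k hz0 hz.symm)
      · rw [leibniz_lie, hx, hz]
        simp only [smul_lie, lie_smul]
        push_cast
        module
  have hfin := (LieAlgebra.ad k L h).finite_hasEigenvalue
  refine Set.infinite_of_injective_forall_mem (f := fun j : ℕ => μ + j * a) ?_ ?_ hfin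
  · intro i j hij
    simpa [ha] using hij
  · intro j
    obtain ⟨z, hz0, hz⟩ := key j
    exact hasEigenvalue_of_hasEigenvector (hasEigenvector_iff.2 ⟨mem_eigenspace_iff.2 hz, hz0⟩)

theorem maxGenEigenspace_eq_bot_of_forall [FiniteDimensional k L] {h : L} {μ : k}
    (hμ : ∀ y : L, ⁅h, y⁆ = μ • y → y = 0) : (LieAlgebra.ad k L h).maxGenEigenspace μ = ⊥ := by
  by_contra hne
  have h1 : (LieAlgebra.ad k L h).HasEigenvalue μ := HasUnifEigenvalue.lt zero_lt_one hne
  obtain ⟨y, hy⟩ := h1.exists_hasEigenvector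
  exact hy.2 (hμ y hy.apply_eq_smul)

/-- A self-centralizing Lie algebra of dimension at least two over an algebraically closed field
contains `h, x` with `⁅h, x⁆ = x ≠ 0`. -/
theorem IsSelfCentralizing.exists_lie_eq_self [IsAlgClosed k] [FiniteDimensional k L]
    (hL : IsSelfCentralizing k L) (hr : 1 < Module.rank k L) :
    ∃ h x : L, x ≠ 0 ∧ ⁅h, x⁆ = x := by
  by_contra! hne
  have hev : ∀ (h : L) (μ : k), μ ≠ 0 → ∀ y : L, ⁅h, y⁆ = μ • y → y = 0 := by
    intro h μ hμ y hy
    by_contra hy0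
    refine hne (μ⁻¹ • h) y hy0 ?_
    rw [smul_lie, hy, inv_smul_smul₀ hμ]
  -- With zero as the only eigenvalue, each `ad h` is nilpotent and Engel's theorem applies.
  have hnil : LieRing.IsNilpotent L := by
    rw [LieAlgebra.isNilpotent_iff_forall (R := k)]
    intro h
    have htop : (LieAlgebra.ad k L h).maxGenEigenspace 0 = ⊤ := by
      rw [eq_top_iff, ← iSup_maxGenEigenspace_eq_top (LieAlgebra.ad k L h)]
      refine iSup_le fun μ => ?_
      by_cases hμ : μ = 0
      · rw [hμ]
      · rw [maxGenEigenspace_eq_bot_of_forall (hev h μ hμ)]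
        exact bot_le
    rw [maxGenEigenspace_eq_genEigenspace_finrank, genEigenspace_nat, zero_smul, sub_zero,
      LinearMap.ker_eq_top] at htop
    exact ⟨_, htop⟩
  have hnt : Nontrivial L := by
    rw [← rank_pos_iff_nontrivial (R := k)]
    exact zero_lt_one.trans hr
  have := LieModule.nontrivial_max_triv_of_isNilpotent k L L
  obtain ⟨⟨z, hz⟩, hz0⟩ := exists_ne (0 : LieModule.maxTrivSubmodule k L L)
  refine hr.not_ge (rank_le_one_iff.2 ⟨z, fun y => ?_⟩)
  obtain ⟨c, hc⟩ := hL z (by simpa using hz0) y (by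
    rw [← lie_skew, (LieModule.mem_maxTrivSubmodule k L L z).1 hz y, neg_zero])
  exact ⟨c, hc.symm⟩

/-- Generalized eigenvectors for the eigenvalue `a - 1` are mapped by `ad x` to generalized
eigenvectors for the eigenvalue `a`. -/
theorem lie_mem_maxGenEigenspace_add_one {h x z : L} (hx : ⁅h, x⁆ = x) {a b : k} (hab : 1 + a = b)
    (hz : z ∈ (LieAlgebra.ad k L h).maxGenEigenspace a) :
    ⁅x, z⁆ ∈ (LieAlgebra.ad k L h).maxGenEigenspace b := by
  have hx1 : x ∈ (LieAlgebra.ad k L h).maxGenEigenspace 1 :=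
    (LieAlgebra.ad k L h).genEigenspace 1 |>.monotone (le_top (a := 1))
      (mem_eigenspace_iff.2 (by simpa using hx))
  rw [← hab]
  exact LieModule.lie_mem_maxGenEigenspace_toEnd hx1 hz

/-- `ad x` shifts the generalized eigenspaces `V a` of `ad h` by one and has kernel `k x`.
Descending from `V 2 = 0`, each space is controlled by the one above it, modulo `x`. -/
theorem IsSelfCentralizing.span_or_exists [CharZero k] [IsAlgClosed k] [FiniteDimensional k L]
    (hL : IsSelfCentralizing k L) {h x : L} (hx0 : x ≠ 0) (hx : ⁅h, x⁆ = x) :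
    (∀ z : L, ∃ a b : k, z = a • h + b • x) ∨
    ∃ y : L, ⁅h, y⁆ = -y ∧ ⁅x, y⁆ = (2 : k) • h ∧
      ∀ z : L, ∃ a b c : k, z = a • h + b • x + c • y := by
  have hx' : ⁅h, x⁆ = (1 : k) • x := by rw [one_smul, hx]
  have hxh : ⁅x, h⁆ = -x := by rw [← lie_skew, hx]
  have hh0 : h ≠ 0 := by
    rintro rfl
    exact hx0 (by simpa using hx.symm)
  have hev : ∀ μ : k, μ ≠ 1 → μ ≠ 0 → μ ≠ -1 → ∀ y : L, ⁅h, y⁆ = μ • y → y = 0 := by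
    intro μ h1 h0 hm1 y hy
    by_contra hy0
    obtain ⟨j, hj⟩ := hL.exists_add_smul_eq one_ne_zero hx0 hx' hy0 hy
    -- Exchanging the roles of `x` and `y` gives `1 = (1 - i) * μ`, while `μ = 1 - j`; so `μ` is a
    -- unit of `ℤ`.
    obtain ⟨i, hi⟩ := hL.exists_add_smul_eq h0 hy0 hy hx0 hx'
    have hμ : μ = ((1 - j : ℤ) : k) := by push_cast; linear_combination hj
    rw [hμ] at hi h1 h0 hm1
    have hi' : (1 : ℤ) = (1 - i) * (1 - j) := by
      have : ((1 : ℤ) : k) = (((1 - i) * (1 - j) : ℤ) : k) := by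
        push_cast at hi ⊢
        linear_combination hi
      exact_mod_cast this
    rcases Int.isUnit_iff.1 (IsUnit.of_mul_eq_one_right _ hi'.symm) with h2 | h2
    · exact h1 (by rw [h2]; simp)
    · exact hm1 (by rw [h2]; simp)
  let V : k → Submodule k L := (LieAlgebra.ad k L h).maxGenEigenspace
  have hV2 : V 2 = ⊥ :=
    maxGenEigenspace_eq_bot_of_forall (hev 2 (by norm_num) (by norm_num) (by norm_num))
  have hV1 : ∀ z ∈ V 1, ∃ b : k, z = b • x := fun z hz => hL x hx0 z (by
    have h1 : ⁅x, z⁆ ∈ V 2 := lie_mem_maxGenEigenspace_add_one hx one_add_one_eq_two hz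
    rwa [hV2, Submodule.mem_bot] at h1)
  have hV0 : ∀ z ∈ V 0, ∃ a b : k, z = a • h + b • x := by
    intro z hz
    obtain ⟨c, hc⟩ := hV1 _ (lie_mem_maxGenEigenspace_add_one hx (add_zero 1) hz)
    obtain ⟨d, hd⟩ := hL x hx0 (z + c • h) (by rw [lie_add, lie_smul, hc, hxh]; module)
    exact ⟨-c, d, by rw [← hd]; module⟩
  have hV : ∀ W : Submodule k L, V 1 ≤ W → V 0 ≤ W → V (-1) ≤ W → W = ⊤ := by
    intro W h1 h0 hm1
    rw [eq_top_iff, ← iSup_maxGenEigenspace_eq_top (LieAlgebra.ad k L h)]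
    refine iSup_le fun μ => ?_
    by_cases e1 : μ = 1
    · rwa [e1]
    by_cases e0 : μ = 0
    · rwa [e0]
    by_cases em1 : μ = -1
    · rwa [em1]
    rw [maxGenEigenspace_eq_bot_of_forall (hev μ e1 e0 em1)]
    exact bot_le
  by_cases hy : ∀ y : L, ⁅h, y⁆ = (-1 : k) • y → y = 0
  · left
    have htop : Submodule.span k {h, x} = ⊤ := by
      refine hV _ ?_ ?_ ?_
      · intro z hz
        obtain ⟨b, rfl⟩ := hV1 z hz
        exact Submodule.mem_span_pair.2 ⟨0, b, by simp⟩
      · intro z hz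
        obtain ⟨a, b, rfl⟩ := hV0 z hz
        exact Submodule.mem_span_pair.2 ⟨a, b, rfl⟩
      · rw [show V (-1) = ⊥ from maxGenEigenspace_eq_bot_of_forall hy]
        exact bot_le
    intro z
    obtain ⟨a, b, hab⟩ := Submodule.mem_span_pair.1 (htop.ge (show z ∈ ⊤ from trivial))
    exact ⟨a, b, hab.symm⟩
  · right
    push Not at hy
    obtain ⟨w, hw, hw0⟩ := hy
    -- The bracket has weight `1 - 1 = 0`, so it commutes with `h`.
    obtain ⟨c, hc⟩ := hL h hh0 ⁅x, w⁆ (by rw [leibniz_lie, hx, hw, lie_smul]; module)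
    have hc0 : c ≠ 0 := by
      rintro rfl
      obtain ⟨d, rfl⟩ := hL x hx0 w (by rw [hc, zero_smul])
      rw [lie_smul, hx, neg_smul, one_smul] at hw
      have h2 : (2 : k) • (d • x) = 0 := by
        rw [two_smul]
        nth_rewrite 1 [hw]
        exact neg_add_cancel _
      exact hw0 ((smul_eq_zero.1 h2).resolve_left two_ne_zero)
    have htop : Submodule.span k {h, x, w} = ⊤ := by
      have hV0' : ∀ z ∈ V 0, z ∈ Submodule.span k {h, x, w} := by
        intro z hz
        obtain ⟨a, b, rfl⟩ := hV0 z hz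
        exact Submodule.mem_span_triple.2 ⟨a, b, 0, by simp⟩
      refine hV _ ?_ hV0' ?_
      · intro z hz
        obtain ⟨b, rfl⟩ := hV1 z hz
        exact Submodule.mem_span_triple.2 ⟨0, b, 0, by simp⟩
      · intro z hz
        obtain ⟨a, b, hab⟩ := hV0 _ (lie_mem_maxGenEigenspace_add_one hx (add_neg_cancel 1) hz)
        -- Since `⁅x, w⁆ = c • h` and `⁅x, h⁆ = -x`, these corrections cancel `⁅x, z⁆ = a • h + b •
        -- x`.
        obtain ⟨d, hd⟩ := hL x hx0 (z - (a / c) • w + b • h) (by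
          rw [lie_add, lie_sub, lie_smul, lie_smul, hab, hc, hxh, smul_smul, div_mul_cancel₀ _ hc0]
          module)
        exact Submodule.mem_span_triple.2 ⟨-b, d, a / c, by rw [← hd]; module⟩
    refine ⟨(2 / c) • w, ?_, ?_, fun z => ?_⟩
    · rw [lie_smul, hw]; module
    · rw [lie_smul, hc, smul_smul, div_mul_cancel₀ _ hc0]
    · obtain ⟨a, b, d, habd⟩ := Submodule.mem_span_triple.1 (htop.ge (show z ∈ ⊤ from trivial))
      refine ⟨a, b, d * (c / 2), ?_⟩
      rw [← habd, smul_smul, show d * (c / 2) * (2 / c) = d by field_simp]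

theorem nonempty_equiv_nonabelianTwoDim {h x : L} (hx0 : x ≠ 0) (hx : ⁅h, x⁆ = x)
    (hspan : ∀ z : L, ∃ a b : k, z = a • h + b • x) :
    Nonempty (L ≃ₗ⁅k⁆ nonabelianTwoDim k) := by
  have hxh : ⁅x, h⁆ = -x := by rw [← lie_skew, hx]
  let φ : nonabelianTwoDim k →ₗ⁅k⁆ L :=
    { toFun := fun M => M.1 0 0 • h + M.1 0 1 • x
      map_add' := by
        intro M N
        rw [show (M + N).1 = M.1 + N.1 from rfl]
        simp only [Matrix.add_apply]
        module
      map_smul' := by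
        intro c M
        rw [show (c • M).1 = c • M.1 from rfl]
        simp only [Matrix.smul_apply, RingHom.id_apply, smul_eq_mul]
        module
      map_lie' := by
        rintro ⟨M, hM1, hM2⟩ ⟨N, hN1, hN2⟩
        simp only [LieSubalgebra.coe_bracket, LieRing.of_associative_ring_bracket,
          Matrix.sub_apply, Matrix.mul_apply, Fin.sum_univ_two, hM1, hM2, hN1, hN2, lie_add,
          add_lie, lie_smul, smul_lie, lie_self, hx, hxh]
        module }
  have hφ : ∀ M, φ M = M.1 0 0 • h + M.1 0 1 • x := fun _ => rfl
  refine ⟨(LieEquiv.ofBijective φ ⟨?_, fun z => ?_⟩).symm⟩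
  · rw [injective_iff_map_eq_zero]
    rintro ⟨M, hM1, hM2⟩ h0
    rw [hφ] at h0
    have h00 : M 0 0 = 0 := by
      -- `ad x` kills the `x` term and isolates the coefficient of `h`.
      have h1 := congrArg (fun z => ⁅x, z⁆) h0
      simpa [hxh, hx0] using h1
    have h01 : M 0 1 = 0 := by simpa [h00, hx0] using h0
    ext i j
    fin_cases i <;> fin_cases j <;> simp [h00, h01, hM1, hM2]
  · obtain ⟨a, b, rfl⟩ := hspan z
    refine ⟨⟨!![a, b; 0, 0], by simp [nonabelianTwoDim]⟩, ?_⟩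
    rw [hφ]
    simp

theorem nonempty_equiv_sl [CharZero k] {h x y : L} (hx0 : x ≠ 0) (hx : ⁅h, x⁆ = x)
    (hy : ⁅h, y⁆ = -y) (hxy : ⁅x, y⁆ = (2 : k) • h)
    (hspan : ∀ z : L, ∃ a b c : k, z = a • h + b • x + c • y) :
    Nonempty (L ≃ₗ⁅k⁆ LieAlgebra.SpecialLinear.sl (Fin 2) k) := by
  have hxh : ⁅x, h⁆ = -x := by rw [← lie_skew, hx]
  have hyh : ⁅y, h⁆ = y := by rw [← lie_skew, hy, neg_neg]
  have hyx : ⁅y, x⁆ = -((2 : k) • h) := by rw [← lie_skew, hxy]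
  have htr : ∀ M ∈ LieAlgebra.SpecialLinear.sl (Fin 2) k, M 1 1 = -M 0 0 := by
    intro M hM
    have h1 : M.trace = 0 := hM
    rw [Matrix.trace_fin_two] at h1
    exact eq_neg_of_add_eq_zero_right h1
  -- Here `h` corresponds to `diag(1/2, -1/2)`, whence the factor 2; `x` and `y` correspond to `E₀₁`
  -- and `E₁₀`.
  let φ : LieAlgebra.SpecialLinear.sl (Fin 2) k →ₗ⁅k⁆ L :=
    { toFun := fun M => (2 * M.1 0 0) • h + M.1 0 1 • x + M.1 1 0 • y
      map_add' := by
        intro M N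
        rw [show (M + N).1 = M.1 + N.1 from rfl]
        simp only [Matrix.add_apply]
        module
      map_smul' := by
        intro c M
        rw [show (c • M).1 = c • M.1 from rfl]
        simp only [Matrix.smul_apply, RingHom.id_apply, smul_eq_mul]
        module
      map_lie' := by
        rintro ⟨M, hM⟩ ⟨N, hN⟩
        simp only [LieSubalgebra.coe_bracket, LieRing.of_associative_ring_bracket,
          Matrix.sub_apply, Matrix.mul_apply, Fin.sum_univ_two, htr M hM, htr N hN, lie_add,
          add_lie, lie_smul, smul_lie, lie_self, hx, hxh, hy, hyh, hxy, hyx]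
        module }
  have hφ : ∀ M, φ M = (2 * M.1 0 0) • h + M.1 0 1 • x + M.1 1 0 • y := fun _ => rfl
  refine ⟨(LieEquiv.ofBijective φ ⟨?_, fun z => ?_⟩).symm⟩
  · rw [injective_iff_map_eq_zero]
    rintro ⟨M, hM⟩ h0
    rw [hφ] at h0
    have h10 : M 1 0 = 0 := by
      -- `(ad x)²` kills `h` and `x` and sends `y` to `-2x`.
      have h1 := congrArg (fun z => ⁅x, ⁅x, z⁆⁆) h0
      simpa [hxh, hxy, hx0] using h1
    have h00 : M 0 0 = 0 := by
      have h1 := congrArg (fun z => ⁅x, z⁆) h0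
      simpa [hxh, h10, hx0] using h1
    have h01 : M 0 1 = 0 := by simpa [h00, h10, hx0] using h0
    ext i j
    fin_cases i <;> fin_cases j <;> simp [h00, h01, h10, htr M hM]
  · obtain ⟨a, b, c, rfl⟩ := hspan z
    refine ⟨⟨!![a / 2, b; c, -(a / 2)], ?_⟩, ?_⟩
    · change Matrix.trace !![a / 2, b; c, -(a / 2)] = 0
      rw [Matrix.trace_fin_two]
      simp
    · rw [hφ]
      simp [mul_div_cancel₀]

theorem IsSelfCentralizing.classification [CharZero k] [IsAlgClosed k] [FiniteDimensional k L]
    (hL : IsSelfCentralizing k L) :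
    Nonempty (L ≃ₗ⁅k⁆ nonabelianTwoDim k) ∨
      Nonempty (L ≃ₗ⁅k⁆ LieAlgebra.SpecialLinear.sl (Fin 2) k) ∨ Module.rank k L ≤ 1 := by
  by_cases hr : Module.rank k L ≤ 1
  · exact Or.inr (Or.inr hr)
  obtain ⟨h, x, hx0, hx⟩ := hL.exists_lie_eq_self (not_le.1 hr)
  rcases hL.span_or_exists hx0 hx with hs | ⟨y, hy, hxy, hs⟩
  · exact Or.inl (nonempty_equiv_nonabelianTwoDim hx0 hx hs)
  · exact Or.inr (Or.inl (nonempty_equiv_sl hx0 hx hy hxy hs))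

end AlgClosed

end SelfCent

theorem mainTheorem2 (k : Type u) [Field k] [CharZero k] :
    (∀ (L : Type v) [LieRing L] [LieAlgebra k L], SelfCent.IsSelfCentralizing k L →
      -- (a) subalgebras
      (∀ K : LieSubalgebra k L, SelfCent.IsSelfCentralizing k K) ∧
      -- (b) finite-dimensional ideals
      (∀ (I : LieIdeal k L) (n : ℕ), 1 < n → Module.rank k I = n →
        Module.rank k L ≤ ((n ^ 2 : ℕ) : Cardinal.{v})) ∧
      (∀ I : LieIdeal k L, Module.rank k I = 1 → Module.rank k L ≤ 2) ∧
      -- (c) the infinite-dimensional case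
      (¬ FiniteDimensional k L → ∀ I : LieIdeal k L, FiniteDimensional k I → I = ⊥) ∧
      -- (d) common eigenvectors
      (∀ α β x : L, LinearIndependent k ![α, β] →
        (∃ a : k, Module.End.HasEigenvector (LieAlgebra.ad k L α) a x) →
        (∃ b : k, Module.End.HasEigenvector (LieAlgebra.ad k L β) b x) →
        ∃ c : k, x = c • ⁅α, β⁆) ∧
      -- (e) no simultaneously diagonalizing basis
      (∀ α β : L, LinearIndependent k ![α, β] →
        ¬ ∃ (ι : Type v) (b : Module.Basis ι k L),
          SelfCent.IsAdDiagonal b α ∧ SelfCent.IsAdDiagonal b β) ∧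
      -- (f) indecomposability
      SelfCent.IsIndecomposable k L ∧
      -- (g) semisimplicity
      (2 < Module.rank k L → SelfCent.IsSemisimple k L) ∧
      -- (h) the finite-dimensional case over an algebraically closed field
      (FiniteDimensional k L → IsAlgClosed k →
        Nonempty (L ≃ₗ⁅k⁆ SelfCent.nonabelianTwoDim k) ∨
        Nonempty (L ≃ₗ⁅k⁆ LieAlgebra.SpecialLinear.sl (Fin 2) k) ∨
        Module.rank k L ≤ 1)) ∧
    -- generalized Witt algebras
    (∀ (A : Subalgebra k (LaurentSeries k)) (hA : SelfCent.IsStable A),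
      ¬ FiniteDimensional k (SelfCent.Witt A hA) →
      SelfCent.IsSemisimple k (SelfCent.Witt A hA) ∧
        SelfCent.IsIndecomposable k (SelfCent.Witt A hA)) := by
  refine ⟨fun L _ _ h => ⟨h.subalgebra, h.rank_le_sq, h.rank_le_two, h.ideal_eq_bot, ?_, ?_,
    h.isIndecomposable, h.isSemisimple, ?_⟩, fun A hA hinf => ?_⟩
  · rintro α β x hli ⟨a, ha⟩ ⟨b, hb⟩
    exact h.eq_smul_lie hli ha.2 ha.apply_eq_smul hb.apply_eq_smul
  · rintro α β hli ⟨ι, b, hα, hβ⟩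
    exact h.not_isAdDiagonal hli b hα hβ
  · intro _ _
    exact h.classification
  · have h := SelfCent.isSelfCentralizing_witt A hA
    exact ⟨h.isSemisimple (SelfCent.two_lt_rank hinf), h.isIndecomposable⟩
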